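/- Let $m,n\ge 1$ and let $\Omega\subset\mathbb R^n$ be a domain (a nonempty connected open set) which is either (i) bounded, or (ii) unbounded and such that, for some $h>1$, the cone $$K_h=\Bigl\{x\in\mathbb R^n:\; x_n^2>h^2\sum_{i=1}^{n-1}x_i^2,\; x_n<0\Bigr\}$$ is contained in the complement of $\Omega$. For $1\le j,k\le n$ let $\mathcal B_{jk}:\Omega\times\mathbb R^{mn}\to\mathbb R^{m\times m}$ be bounded matrix-valued functions such that the quasilinear system $$\sum_{j,k=1}^n \mathcal B_{jk}(x,D_x u)\,\frac{\partial^2 u}{\partial x_j\partial x_k}=0,\qquad u=(u_1,\dots,u_m),\qquad D_x u=\Bigl(\frac{\partial u_i}{\partial x_j}\Bigr)_{i,j}, \tag{1}$$ is uniformly strongly elliptic in $\Omega$: there is a constant $\delta>0$ with $$\Bigl(\sum_{j,k=1}^n\mathcal B_{jk}(x,\eta)\sigma_j\sigma_k\,\zeta,\ \zeta\Bigr)\ \ge\ \delta|\sigma|^2|\zeta|^2$$ for all $x\in\Omega$, $\eta\in\mathbb R^{mn}$, $\sigma\in\mathbb R^n$, $\zeta\in\mathbb R^m$. Let $\mathfrak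 S\subset\mathbb R^m$ be a convex body, that is, the closure of a nonempty open convex set $D\ne\mathbb R^m$. Let $\mathfrak N_{\mathfrak S}$ be the set of all vectors $\nu(a)$, where $a$ runs through the points of $\partial\mathfrak S$ at which there is exactly one unit outward normal (exactly one unit vector $\nu$ with $(y-a,\nu)\le 0$ for all $y\in\mathfrak S$) and $\nu(a)$ is this normal. Suppose that there are functions $b_{jk}:\Omega\times\mathbb R^{mn}\times\mathfrak N_{\mathfrak S}\to\mathbb R$, $1\le j,k\le n$, such that $${}^t\mathcal B_{jk}(x,\eta)\,\nu=b_{jk}(x,\eta;\nu)\,\nu$$ for all $x\in\Omega$, $\eta\in\mathbb R^{mn}$, $\nu\in\mathfrak N_{\mathfrak S}$ and $1\le j,k\le n$, where ${}^t\mathcal B_{jk}$ is the transposed matrix. Then $\mathfrak S$ is invariant for the system (1) in $\Omega$: every bounded function $u:\overline\Omega\to\mathbb R^m$ that is continuous on $\overline\Omega$, twice continuously differentiable in $\Omega$ and satisfies (1) in $\Omega$, and for which $u(x)\in\mathfrak S$ for all $x\in\partial\Omega$, satisfies $u(x)\in\mathfrak S$ for all $x\in\overline\Omega$. -/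

import Mathlib

open scoped Matrix

/-- A domain: a nonempty connected open set. -/
def IsDomainSet {n : ℕ} (Ω : Set (EuclideanSpace ℝ (Fin n))) : Prop :=
  IsOpen Ω ∧ IsConnected Ω

/-- The open cone `x_n ^ 2 > h ^ 2 * ∑_{i < n} x_i ^ 2`, `x_n < 0` in `ℝⁿ`, where `n = d + 1`. -/
def coneK {d : ℕ} (h : ℝ) : Set (EuclideanSpace ℝ (Fin (d + 1))) :=
  {x | h ^ 2 * ∑ i : Fin d, (x i.castSucc) ^ 2 < (x (Fin.last d)) ^ 2 ∧ x (Fin.last d) < 0}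

/-- A convex body: the closure of a convex proper subdomain of `ℝᵐ`
(a convex set is connected as soon as it is nonempty). -/
def IsConvexBody {m : ℕ} (S : Set (EuclideanSpace ℝ (Fin m))) : Prop :=
  ∃ D : Set (EuclideanSpace ℝ (Fin m)),
    IsOpen D ∧ Convex ℝ D ∧ D.Nonempty ∧ D ≠ Set.univ ∧ S = closure D

/-- `ν` is a unit vector normal to a hyperplane that supports `S` at `a`, pointing out of `S`. -/
def IsUnitOutwardNormal {m : ℕ} (S : Set (EuclideanSpace ℝ (Fin m)))
    (a ν : EuclideanSpace ℝ (Fin m)) : Prop :=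
  ‖ν‖ = 1 ∧ ∀ y ∈ S, inner ℝ (y - a) ν ≤ 0

/-- The set of all vectors `ν(a)`, where `a` runs through the boundary points of `S` at which
there is exactly one unit outward normal, and `ν(a)` is that normal. -/
def unitNormals {m : ℕ} (S : Set (EuclideanSpace ℝ (Fin m))) :
    Set (EuclideanSpace ℝ (Fin m)) :=
  {ν | ∃ a ∈ frontier S, IsUnitOutwardNormal S a ν ∧
    ∀ ν₁, IsUnitOutwardNormal S a ν₁ → ν₁ = ν}

/-- The partial derivative `∂u/∂x_j`. -/
noncomputable def pderiv {n m : ℕ} (j : Fin n)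
    (u : EuclideanSpace ℝ (Fin n) → EuclideanSpace ℝ (Fin m)) :
    EuclideanSpace ℝ (Fin n) → EuclideanSpace ℝ (Fin m) :=
  fun x => fderiv ℝ u x (EuclideanSpace.single j 1)

/-- The array `D_x u (x)` of all first partial derivatives `∂u_i/∂x_j`, an element of `ℝ^{mn}`. -/
noncomputable def gradient_array {n m : ℕ}
    (u : EuclideanSpace ℝ (Fin n) → EuclideanSpace ℝ (Fin m))
    (x : EuclideanSpace ℝ (Fin n)) : Matrix (Fin m) (Fin n) ℝ :=
  Matrix.of fun i j => pderiv j u x i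

/-- Coefficients `B j k x η` of a quasilinear second order system: `(m × m)`-matrices depending
on `x` and on `η ∈ ℝ^{mn}`. Only the values for `x` in the domain are ever used. -/
abbrev QuasilinearCoeffs (n m : ℕ) : Type :=
  Fin n → Fin n → EuclideanSpace ℝ (Fin n) → Matrix (Fin m) (Fin n) ℝ → Matrix (Fin m) (Fin m) ℝ

/-- The coefficients are bounded on `Ω × ℝ^{mn}`. -/
def BoundedCoeffs {n m : ℕ} (Ω : Set (EuclideanSpace ℝ (Fin n)))
    (B : QuasilinearCoeffs n m) : Prop :=
  ∃ C : ℝ, ∀ j k, ∀ x ∈ Ω, ∀ η, ∀ p q, |B j k x η p q| ≤ C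

/-- Uniform strong ellipticity in `Ω`. -/
def UniformlyStronglyElliptic {n m : ℕ} (Ω : Set (EuclideanSpace ℝ (Fin n)))
    (B : QuasilinearCoeffs n m) : Prop :=
  ∃ δ : ℝ, 0 < δ ∧ ∀ x ∈ Ω, ∀ (η : Matrix (Fin m) (Fin n) ℝ)
    (σ : EuclideanSpace ℝ (Fin n)) (ζ : EuclideanSpace ℝ (Fin m)),
    δ * ‖σ‖ ^ 2 * ‖ζ‖ ^ 2 ≤
      ((∑ j, ∑ k, (σ j * σ k) • B j k x η) *ᵥ WithLp.ofLp ζ) ⬝ᵥ WithLp.ofLp ζ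

/-- `u` is a bounded classical solution of `∑ B_jk(x, D_x u) ∂²u/∂x_j∂x_k = 0` in `Ω` that is
continuous in the closure of `Ω`. -/
def IsBoundedClassicalSolution {n m : ℕ} (Ω : Set (EuclideanSpace ℝ (Fin n)))
    (B : QuasilinearCoeffs n m)
    (u : EuclideanSpace ℝ (Fin n) → EuclideanSpace ℝ (Fin m)) : Prop :=
  ContinuousOn u (closure Ω) ∧ (∃ M : ℝ, ∀ x ∈ closure Ω, ‖u x‖ ≤ M) ∧ ContDiffOn ℝ 2 u Ω ∧
    ∀ x ∈ Ω, ∑ j, ∑ k,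
      B j k x (gradient_array u x) *ᵥ WithLp.ofLp (pderiv j (pderiv k u) x) = 0

/-- `S` is invariant for the system with coefficients `B` in `Ω`. -/
def IsInvariantFor {n m : ℕ} (S : Set (EuclideanSpace ℝ (Fin m)))
    (Ω : Set (EuclideanSpace ℝ (Fin n))) (B : QuasilinearCoeffs n m) : Prop :=
  ∀ u : EuclideanSpace ℝ (Fin n) → EuclideanSpace ℝ (Fin m),
    IsBoundedClassicalSolution Ω B u →
    (∀ x ∈ frontier Ω, u x ∈ S) → ∀ x ∈ closure Ω, u x ∈ S

open scoped Matrix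

open Metric Set Filter Topology

/-! A value `u x₀` outside `S` lies strictly beyond a supporting hyperplane at some boundary point
`c` with a unique normal `ν` (`IsConvexBody.exists_mem_unitNormals_inner_pos`). Since `ν` is an
eigenvector of every transposed coefficient, taking the inner product of the system with `ν`
decouples it: `f = (u - c, ν)` solves one scalar equation whose coefficients are the eigenvalues
evaluated along `D_x u`. Strong ellipticity with `ζ = ν` makes that equation uniformly elliptic. As
`f ≤ 0` on `∂Ω`, a maximum principle gives `f x₀ ≤ 0`, a contradiction.

The maximum principle is the weak one (`le_of_ellipticOp_nonneg`) when `Ω` is bounded. When `Ω`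
omits a cone, an exponential barrier centred in the cone lowers any upper bound `M ≥ 0` of `f` by a
fixed factor `θ < 1`, and iteration drives it to `0`. Both arguments are pointwise in the
coefficients, so no continuity or symmetry of them is needed. -/

/-- The operator `∑ a_jk ∂²f/∂x_j∂x_k` at the point `x`, with constant coefficients `a`. -/
noncomputable def ellipticOp {n : ℕ} (a : Fin n → Fin n → ℝ)
    (f : EuclideanSpace ℝ (Fin n) → ℝ) (x : EuclideanSpace ℝ (Fin n)) : ℝ :=
  ∑ j, ∑ k, a j k *
    fderiv ℝ (fderiv ℝ f) x (EuclideanSpace.single j 1) (EuclideanSpace.single k 1)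

/-- The quadratic form of `a` is bounded below by `δ |σ|²`. -/
def IsEllipticArray {n : ℕ} (δ : ℝ) (a : Fin n → Fin n → ℝ) : Prop :=
  ∀ σ : EuclideanSpace ℝ (Fin n), δ * ‖σ‖ ^ 2 ≤ ∑ j, ∑ k, a j k * (σ j * σ k)

/-! ### Second derivatives: local maxima and explicit Hessians. -/

section SecondDerivative

variable {E : Type*} [NormedAddCommGroup E]

lemma ContDiffAt.differentiableAt_fderiv_of_two [NormedSpace ℝ E] {f : E → ℝ} {x : E}
    (hf : ContDiffAt ℝ 2 f x) : DifferentiableAt ℝ (fderiv ℝ f) x :=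
  (hf.fderiv_right (m := 1) (by norm_num)).differentiableAt (by norm_num)

lemma ContDiffAt.eventually_differentiableAt_of_two [NormedSpace ℝ E] {f : E → ℝ} {x : E}
    (hf : ContDiffAt ℝ 2 f x) : ∀ᶠ y in 𝓝 x, DifferentiableAt ℝ f y :=
  (hf.eventually (by simp)).mono fun _ hy => hy.differentiableAt (by norm_num)

/-- The Hessian at a local maximum is negative semidefinite. -/
lemma IsLocalMax.fderiv_fderiv_nonpos [NormedSpace ℝ E] {f : E → ℝ} {x : E}
    (hf : ContDiffAt ℝ 2 f x) (hmax : IsLocalMax f x) (v : E) :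
    fderiv ℝ (fderiv ℝ f) x v v ≤ 0 := by
  by_contra! hpos
  set l : ℝ → E := fun t => x + t • v with hl
  have hlc : Continuous l := by fun_prop
  have hl0 : l 0 = x := by simp [hl]
  have htend : Tendsto l (𝓝 0) (𝓝 x) := by simpa [hl0] using hlc.tendsto 0
  have hld : ∀ t, HasDerivAt l v t := fun t =>
    (((hasDerivAt_id t).smul_const v).const_add x).congr_deriv (one_smul _ _)
  have hd1 : ∀ᶠ t in 𝓝 (0 : ℝ), deriv (f ∘ l) t = fderiv ℝ f (l t) v :=
    (htend.eventually hf.eventually_differentiableAt_of_two).mono fun t ht =>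
      (ht.hasFDerivAt.comp_hasDerivAt t (hld t)).deriv
  have hd2 : deriv (deriv (f ∘ l)) 0 = fderiv ℝ (fderiv ℝ f) x v v := by
    rw [EventuallyEq.deriv_eq hd1]
    have h1 : HasFDerivAt (fderiv ℝ f) (fderiv ℝ (fderiv ℝ f) x) (l 0) := by
      rw [hl0]; exact hf.differentiableAt_fderiv_of_two.hasFDerivAt
    have h2 := h1.comp_hasDerivAt (0 : ℝ) (hld 0)
    simpa using (h2.clm_apply (hasDerivAt_const (0 : ℝ) v)).deriv
  have hmax' : IsLocalMax (f ∘ l) 0 := by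
    have := htend.eventually hmax
    simpa [IsLocalMax, IsMaxFilter, hl0] using this
  have hcont : ContinuousAt (f ∘ l) 0 :=
    ContinuousAt.comp (by rw [hl0]; exact hf.continuousAt) hlc.continuousAt
  -- By the second derivative test `0` is also a local minimum, so `f` is locally constant along the
  -- line, against the positive second derivative.
  have hmin : IsLocalMin (f ∘ l) 0 :=
    isLocalMin_of_deriv_deriv_pos (by rw [hd2]; exact hpos) hmax'.deriv_eq_zero hcont
  have hconst : (f ∘ l) =ᶠ[𝓝 0] fun _ => (f ∘ l) 0 := by
    filter_upwards [hmax', hmin] with t h1 h2 using le_antisymm h1 h2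
  have h0 : deriv (f ∘ l) =ᶠ[𝓝 0] fun _ => 0 := by
    simpa using hconst.deriv
  have : deriv (deriv (f ∘ l)) 0 = 0 := by simpa using h0.deriv_eq
  linarith [hd2 ▸ this]

lemma fderiv_fderiv_add_const_mul [NormedSpace ℝ E] {f g : E → ℝ} {x : E} (c : ℝ)
    (hf : ContDiffAt ℝ 2 f x) (hg : ContDiffAt ℝ 2 g x) (v w : E) :
    fderiv ℝ (fderiv ℝ fun y => f y + c * g y) x v w =
      fderiv ℝ (fderiv ℝ f) x v w + c * fderiv ℝ (fderiv ℝ g) x v w := by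
  have h : fderiv ℝ (fun y => f y + c * g y) =ᶠ[𝓝 x]
      fun y => fderiv ℝ f y + c • fderiv ℝ g y := by
    filter_upwards [hf.eventually_differentiableAt_of_two,
      hg.eventually_differentiableAt_of_two] with y h1 h2
    exact (h1.hasFDerivAt.add (h2.hasFDerivAt.const_mul c)).fderiv
  have h' : HasFDerivAt (fun y => fderiv ℝ f y + c • fderiv ℝ g y) _ x :=
    hf.differentiableAt_fderiv_of_two.hasFDerivAt.add
      (hg.differentiableAt_fderiv_of_two.hasFDerivAt.const_smul c)
  rw [h.fderiv_eq, h'.fderiv]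
  simp

variable [InnerProductSpace ℝ E]

lemma fderiv_fderiv_norm_sq (x v w : E) :
    fderiv ℝ (fderiv ℝ fun y : E => ‖y‖ ^ 2) x v w = 2 * inner ℝ v w := by
  have h : fderiv ℝ (fun y : E => ‖y‖ ^ 2) = fun y => (2 : ℝ) • innerSL ℝ y := by
    funext y
    exact (hasStrictFDerivAt_norm_sq y).hasFDerivAt.fderiv.trans (by simp [two_smul])
  have h' : HasFDerivAt (fun y : E => (2 : ℝ) • innerSL ℝ y) _ x :=
    (innerSL ℝ (E := E)).hasFDerivAt.const_smul (2 : ℝ)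
  rw [h, h'.fderiv]
  rfl

lemma fderiv_fderiv_exp_norm_sq (γ : ℝ) (c x v w : E) :
    fderiv ℝ (fderiv ℝ fun y : E => Real.exp (-γ * ‖y - c‖ ^ 2)) x v w =
      2 * γ * Real.exp (-γ * ‖x - c‖ ^ 2) *
        (2 * γ * (inner ℝ (x - c) v * inner ℝ (x - c) w) - inner ℝ v w) := by
  have hE : ∀ y : E, HasFDerivAt (fun y : E => Real.exp (-γ * ‖y - c‖ ^ 2))
      ((-2 * γ * Real.exp (-γ * ‖y - c‖ ^ 2)) • innerSL ℝ (y - c)) y := fun y => by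
    have h1 := ((hasFDerivAt_id y).sub_const c).norm_sq.const_mul (-γ) |>.exp
    refine h1.congr_fderiv ?_
    ext z
    simp
    ring
  rw [show fderiv ℝ (fun y : E => Real.exp (-γ * ‖y - c‖ ^ 2)) = _ from
    funext fun y => (hE y).fderiv]
  have h2 : HasFDerivAt (fun y : E => innerSL ℝ (y - c)) (innerSL ℝ (E := E)) x :=
    (innerSL ℝ (E := E)).hasFDerivAt.comp x ((hasFDerivAt_id x).sub_const c)
  have h3 : HasFDerivAt (fun y : E =>
      (-2 * γ * Real.exp (-γ * ‖y - c‖ ^ 2)) • innerSL ℝ (y - c)) _ x :=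
    ((hE x).const_mul (-2 * γ)).smul h2
  rw [h3.fderiv]
  change (-2 * γ * Real.exp (-γ * ‖x - c‖ ^ 2)) * inner ℝ v w +
    (-2 * γ * (-2 * γ * Real.exp (-γ * ‖x - c‖ ^ 2) * inner ℝ (x - c) v)) *
      inner ℝ (x - c) w = _
  ring

end SecondDerivative

/-! ### Elliptic operators and the weak maximum principle. -/

section EllipticOp

variable {n : ℕ} {a : Fin n → Fin n → ℝ} {δ : ℝ} {f g : EuclideanSpace ℝ (Fin n) → ℝ}
  {x : EuclideanSpace ℝ (Fin n)}

lemma ellipticOp_add_const_mul (c : ℝ) (hf : ContDiffAt ℝ 2 f x) (hg : ContDiffAt ℝ 2 g x) :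
    ellipticOp a (fun y => f y + c * g y) x = ellipticOp a f x + c * ellipticOp a g x := by
  simp only [ellipticOp, fderiv_fderiv_add_const_mul c hf hg, Finset.mul_sum,
    ← Finset.sum_add_distrib]
  exact Finset.sum_congr rfl fun j _ => Finset.sum_congr rfl fun k _ => by ring

lemma IsEllipticArray.card_mul_le_trace (ha : IsEllipticArray δ a) :
    n * δ ≤ ∑ j, a j j := by
  calc n * δ = ∑ _j : Fin n, δ := by simp
    _ ≤ ∑ j, a j j := Finset.sum_le_sum fun j _ => by
      simpa [Finset.sum_ite_eq, PiLp.single_apply] using ha (EuclideanSpace.single j 1)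

lemma sum_mul_inner_single (a : Fin n → Fin n → ℝ) :
    ∑ j, ∑ k, a j k * inner ℝ (EuclideanSpace.single j (1 : ℝ)) (EuclideanSpace.single k (1 : ℝ))
      = ∑ j, a j j := by
  simp [EuclideanSpace.inner_single_left, PiLp.single_apply]

lemma ellipticOp_norm_sq (a : Fin n → Fin n → ℝ) (x : EuclideanSpace ℝ (Fin n)) :
    ellipticOp a (fun y => ‖y‖ ^ 2) x = 2 * ∑ j, a j j := by
  rw [← sum_mul_inner_single]
  simp only [ellipticOp, fderiv_fderiv_norm_sq, Finset.mul_sum]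
  exact Finset.sum_congr rfl fun j _ => Finset.sum_congr rfl fun k _ => by ring

/-- The barrier: the gradient contributes `2γ ∑ a_jk (x-c)_j (x-c)_k`, which outweighs the trace
once `γ |x-c|²` is large. -/
lemma IsEllipticArray.ellipticOp_exp_nonneg (ha : IsEllipticArray δ a) {γ : ℝ} (hγ : 0 ≤ γ)
    (c : EuclideanSpace ℝ (Fin n)) (h : ∑ j, a j j ≤ 2 * γ * (δ * ‖x - c‖ ^ 2)) :
    0 ≤ ellipticOp a (fun y => Real.exp (-γ * ‖y - c‖ ^ 2)) x := by
  have key : ellipticOp a (fun y => Real.exp (-γ * ‖y - c‖ ^ 2)) x =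
      2 * γ * Real.exp (-γ * ‖x - c‖ ^ 2) *
        (2 * γ * ∑ j, ∑ k, a j k * ((x - c) j * (x - c) k) - ∑ j, a j j) := by
    rw [← sum_mul_inner_single]
    simp only [ellipticOp, fderiv_fderiv_exp_norm_sq, Finset.mul_sum, ← Finset.sum_sub_distrib]
    refine Finset.sum_congr rfl fun j _ => Finset.sum_congr rfl fun k _ => ?_
    simp only [EuclideanSpace.inner_single_right, one_mul, conj_trivial]
    ring
  rw [key]
  have := mul_le_mul_of_nonneg_left (ha (x - c)) (by positivity : 0 ≤ 2 * γ)
  exact mul_nonneg (by positivity) (by linarith)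

open scoped MatrixOrder in
-- Factoring `H = C* C` turns the sum into the quadratic form of `a` summed over the rows of `C`;
-- thus `a` need not be symmetric.
lemma Matrix.PosSemidef.sum_mul_nonneg {H : Matrix (Fin n) (Fin n) ℝ} (hH : H.PosSemidef)
    (ha : IsEllipticArray δ a) (hδ : 0 ≤ δ) : 0 ≤ ∑ j, ∑ k, a j k * H j k := by
  obtain ⟨C, rfl⟩ := CStarAlgebra.nonneg_iff_eq_star_mul_self.mp hH.nonneg
  have h : ∑ j, ∑ k, a j k * (star C * C) j k = ∑ l, ∑ j, ∑ k, a j k * (C l j * C l k) := by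
    simp only [Matrix.mul_apply, Matrix.star_apply, star_trivial, Finset.mul_sum]
    conv_rhs => rw [Finset.sum_comm]
    exact Finset.sum_congr rfl fun j _ => Finset.sum_comm
  rw [h]
  exact Finset.sum_nonneg fun l _ =>
    (by positivity : 0 ≤ δ * ‖WithLp.toLp 2 (C l)‖ ^ 2).trans (ha (WithLp.toLp 2 (C l)))

lemma IsLocalMax.ellipticOp_nonpos (hmax : IsLocalMax f x) (hf : ContDiffAt ℝ 2 f x)
    (ha : IsEllipticArray δ a) (hδ : 0 ≤ δ) : ellipticOp a f x ≤ 0 := by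
  set D := fderiv ℝ (fderiv ℝ f) x with hD
  let H : Matrix (Fin n) (Fin n) ℝ := Matrix.of fun j k =>
    -D (EuclideanSpace.single j 1) (EuclideanSpace.single k 1)
  have hsymm : IsSymmSndFDerivAt ℝ f x := hf.isSymmSndFDerivAt (by simp)
  have hH : H.PosSemidef := by
    refine .of_dotProduct_mulVec_nonneg ?_ fun v => ?_
    · ext j k
      simp only [H, Matrix.conjTranspose_apply, Matrix.of_apply, star_trivial]
      rw [hD, hsymm.eq]
    · have hv : WithLp.toLp 2 v = ∑ j, v j • EuclideanSpace.single j (1 : ℝ) := by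
        ext i
        simp [Finset.sum_apply, Pi.single_apply]
      have h := hmax.fderiv_fderiv_nonpos hf (WithLp.toLp 2 v)
      rw [← hD, hv] at h
      simp only [map_sum, map_smul, sum_apply, smul_apply, smul_eq_mul] at h
      have h2 : star v ⬝ᵥ H *ᵥ v = -∑ k, v k * ∑ j, v j *
          D (EuclideanSpace.single j 1) (EuclideanSpace.single k 1) := by
        simp only [dotProduct, Matrix.mulVec, H, Matrix.of_apply, star_trivial, Pi.star_apply,
          Finset.mul_sum, ← Finset.sum_neg_distrib]
        rw [Finset.sum_comm]
        exact Finset.sum_congr rfl fun j _ => Finset.sum_congr rfl fun k _ => by ring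
      rw [h2]
      linarith
  have := hH.sum_mul_nonneg ha hδ
  simp only [H, Matrix.of_apply, mul_neg, Finset.sum_neg_distrib] at this
  simpa [ellipticOp] using this

end EllipticOp

/-- The weak maximum principle on bounded open sets. -/
lemma le_of_ellipticOp_nonneg {n : ℕ} (hn : 0 < n) {U : Set (EuclideanSpace ℝ (Fin n))}
    (hU : IsOpen U) (hUb : Bornology.IsBounded U)
    {a : EuclideanSpace ℝ (Fin n) → Fin n → Fin n → ℝ} {δ : ℝ} (hδ : 0 < δ)
    (ha : ∀ x ∈ U, IsEllipticArray δ (a x)) {f : EuclideanSpace ℝ (Fin n) → ℝ}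
    (hfc : ContinuousOn f (closure U)) (hf : ContDiffOn ℝ 2 f U)
    (hL : ∀ x ∈ U, 0 ≤ ellipticOp (a x) f x) {K : ℝ} (hbd : ∀ x ∈ frontier U, f x ≤ K) :
    ∀ x ∈ closure U, f x ≤ K := by
  intro x₀ hx₀
  by_contra! hpos
  obtain ⟨R, hR0, hR⟩ := hUb.closure.exists_pos_norm_le
  -- With this `ε` the term `ε ‖y‖²` is at most half the gap `f x₀ - K`, so a maximum point of `F`
  -- still has `f > K` and is interior; there the positive trace contradicts the maximum.
  set ε := (f x₀ - K) / (2 * R ^ 2) with hε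
  have hε0 : 0 < ε := div_pos (by linarith) (by positivity)
  set F := fun y => f y + ε * ‖y‖ ^ 2 with hF
  have hcomp : IsCompact (closure U) := isCompact_of_isClosed_isBounded isClosed_closure hUb.closure
  obtain ⟨x₁, hx₁, hmax⟩ := hcomp.exists_isMaxOn ⟨x₀, hx₀⟩
    (show ContinuousOn F (closure U) by fun_prop)
  have hf1 : K < f x₁ := by
    have h1 : F x₀ ≤ F x₁ := hmax hx₀
    have h2 : ‖x₁‖ ^ 2 ≤ R ^ 2 := pow_le_pow_left₀ (norm_nonneg _) (hR _ hx₁) 2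
    have h3 : ε * R ^ 2 = (f x₀ - K) / 2 := by rw [hε]; field_simp
    have h4 := mul_le_mul_of_nonneg_left h2 hε0.le
    have h5 : 0 ≤ ε * ‖x₀‖ ^ 2 := by positivity
    simp only [hF] at h1
    linarith
  have hxU : x₁ ∈ U := by
    by_contra hxU
    exact hf1.not_ge (hbd x₁ ⟨hx₁, by rwa [hU.interior_eq]⟩)
  have hnhds := hU.mem_nhds hxU
  have hfx : ContDiffAt ℝ 2 f x₁ := hf.contDiffAt hnhds
  have hgx : ContDiffAt ℝ 2 (fun y : EuclideanSpace ℝ (Fin n) => ‖y‖ ^ 2) x₁ :=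
    (contDiff_norm_sq ℝ).contDiffAt
  have hloc : IsLocalMax F x₁ := hmax.isLocalMax (mem_of_superset hnhds subset_closure)
  have h1 := hloc.ellipticOp_nonpos (hfx.add (contDiffAt_const.mul hgx)) (ha x₁ hxU) hδ.le
  rw [ellipticOp_add_const_mul ε hfx hgx, ellipticOp_norm_sq] at h1
  have h2 := (ha x₁ hxU).card_mul_le_trace
  have h3 : 0 < (n : ℝ) * δ := by positivity
  have h4 : 0 < ε * (2 * ∑ j, a x₁ j j) := by
    apply mul_pos hε0; linarith
  linarith [hL x₁ hxU]

/-- With `r = R / (1 + h)` one has `R = r + h r`: points of the ball have `x_n < -h r` and distance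
less than `r` from the axis. -/
lemma ball_subset_coneK {d : ℕ} {h R : ℝ} (hh : 0 < h) (hR : 0 < R) :
    ball (EuclideanSpace.single (Fin.last d) (-R)) (R / (1 + h)) ⊆ coneK (d := d) h := by
  intro x hx
  rw [mem_ball, dist_eq_norm] at hx
  have h1 : ‖x - EuclideanSpace.single (Fin.last d) (-R)‖ ^ 2 < (R / (1 + h)) ^ 2 :=
    pow_lt_pow_left₀ hx (norm_nonneg _) two_ne_zero
  rw [EuclideanSpace.real_norm_sq_eq, Fin.sum_univ_castSucc] at h1
  simp [(Fin.castSucc_lt_last _).ne] at h1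
  set A := ∑ i : Fin d, x i.castSucc ^ 2 with hA
  set t := x (Fin.last d) with ht
  have hA0 : 0 ≤ A := Finset.sum_nonneg fun _ _ => sq_nonneg _
  set r := R / (1 + h) with hr
  have hr0 : 0 < r := by positivity
  have hRr : R = r + h * r := by rw [hr]; field_simp
  have h2 : t + R < r := by
    refine (abs_lt_of_sq_lt_sq' ?_ hr0.le).2
    rw [hRr] at h1 ⊢; nlinarith
  have h3 : 0 < h * r := by positivity
  have h4 : t < -(h * r) := by linarith
  refine ⟨?_, by linarith⟩
  have h5 : A < r ^ 2 := by nlinarith [sq_nonneg (t + R)]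
  nlinarith [mul_lt_mul_of_pos_left h5 (pow_pos hh 2)]

/-! ### A Phragmén–Lindelöf principle outside a cone. -/

section PhragmenLindelof

variable {d : ℕ} {Ω : Set (EuclideanSpace ℝ (Fin (d + 1)))}
  {a : EuclideanSpace ℝ (Fin (d + 1)) → Fin (d + 1) → Fin (d + 1) → ℝ} {δ T h : ℝ}

/-- A bounded subsolution that is nonpositive on the boundary of a domain omitting a cone
improves its upper bound by a fixed factor. -/
lemma exists_factor_of_coneK_subset_compl (hΩ : IsOpen Ω) (hh : 0 < h) (hK : coneK h ⊆ Ωᶜ)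
    (hδ : 0 < δ) (ha : ∀ x ∈ Ω, IsEllipticArray δ (a x)) (hT : ∀ x ∈ Ω, ∑ j, a x j j ≤ T) :
    ∃ θ : ℝ, 0 ≤ θ ∧ θ < 1 ∧ ∀ f : EuclideanSpace ℝ (Fin (d + 1)) → ℝ,
      ContinuousOn f (closure Ω) → ContDiffOn ℝ 2 f Ω →
      (∀ x ∈ Ω, 0 ≤ ellipticOp (a x) f x) → (∀ x ∈ frontier Ω, f x ≤ 0) →
      ∀ M : ℝ, 0 ≤ M → (∀ x ∈ closure Ω, f x ≤ M) → ∀ x ∈ closure Ω, f x ≤ θ * M := by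
  set ρ : ℝ := 1 / (1 + h) with hρ
  have hρ0 : 0 < ρ := by positivity
  have hρ1 : ρ < 1 := by rw [hρ, div_lt_one (by positivity)]; linarith
  have hρ2 : ρ ^ 2 < 1 := by nlinarith
  -- `g₀` is the scale-free exponent: with `γ = g₀ / R²` the barrier is a subsolution wherever `‖x -
  -- y₀‖ ≥ ρ R`. Hence `θ` does not depend on `x₀`.
  set g₀ : ℝ := (|T| + 1) / (2 * δ * ρ ^ 2) with hg₀
  have hg0 : 0 < g₀ := by positivity
  have hgT : T ≤ 2 * g₀ * (δ * ρ ^ 2) := by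
    have : 2 * g₀ * (δ * ρ ^ 2) = |T| + 1 := by rw [hg₀]; field_simp
    linarith [le_abs_self T]
  -- The 9 and 4 come from `‖x - y₀‖ ≥ 3R` on the sphere `‖x‖ = 4R` and from `‖x₀ - y₀‖ ≤ 2R`.
  set β : ℝ := 1 - Real.exp (g₀ * ρ ^ 2 - 9 * g₀) with hβ
  set β' : ℝ := 1 - Real.exp (g₀ * ρ ^ 2 - 4 * g₀) with hβ'
  have hβ'0 : 0 < β' := by rw [hβ', sub_pos, Real.exp_lt_one_iff]; nlinarith
  have hlt : β' < β := by
    rw [hβ, hβ']; apply sub_lt_sub_left; apply Real.exp_lt_exp.2; linarith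
  have hβ0 : 0 < β := hβ'0.trans hlt
  refine ⟨β' / β, by positivity, (div_lt_one hβ0).2 hlt, ?_⟩
  intro f hfc hf hL hbd M hM hfM x₀ hx₀
  set R : ℝ := ‖x₀‖ + 1 with hR
  have hR0 : 0 < R := by positivity
  set y₀ : EuclideanSpace ℝ (Fin (d + 1)) := EuclideanSpace.single (Fin.last d) (-R) with hy₀
  have hy₀n : ‖y₀‖ = R := by simp [hy₀, abs_of_pos hR0]
  have hfar : ∀ x ∈ closure Ω, ρ * R ≤ ‖x - y₀‖ := by
    have hdisj : Disjoint (ball y₀ (R / (1 + h))) (closure Ω) :=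
      (disjoint_left.2 fun x hx hxΩ => hK (ball_subset_coneK hh hR0 hx) hxΩ).closure_right
        isOpen_ball
    intro x hx
    by_contra! hlt
    refine disjoint_left.1 hdisj ?_ hx
    rw [mem_ball, dist_eq_norm]
    exact hlt.trans_eq (by rw [hρ]; ring)
  set γ := g₀ / R ^ 2 with hγ
  have hγ0 : 0 < γ := by positivity
  have hγR : γ * R ^ 2 = g₀ := by rw [hγ]; field_simp
  have hexp_le : ∀ (x : EuclideanSpace ℝ (Fin (d + 1))) (s : ℝ), 0 ≤ s → s * R ≤ ‖x - y₀‖ →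
      Real.exp (-γ * ‖x - y₀‖ ^ 2) ≤ Real.exp (-(s ^ 2 * g₀)) := fun x s hs hx => by
    apply Real.exp_le_exp.2
    have := mul_le_mul_of_nonneg_left (pow_le_pow_left₀ (by positivity) hx 2) hγ0.le
    have e : s ^ 2 * g₀ = γ * (s * R) ^ 2 := by rw [← hγR]; ring
    rw [e]; linarith
  -- Chosen so that `f + c g ≤ M / β` both on `∂Ω`, where `f ≤ 0`, and on the large sphere, where `f
  -- ≤ M`.
  set c := M / β * Real.exp (g₀ * ρ ^ 2) with hc
  have hc0 : 0 ≤ c := by positivity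
  set g : EuclideanSpace ℝ (Fin (d + 1)) → ℝ := fun x => Real.exp (-γ * ‖x - y₀‖ ^ 2) with hg
  have hgs : ContDiff ℝ 2 g :=
    (contDiff_const.mul ((contDiff_id.sub contDiff_const).norm_sq ℝ)).exp
  set U := ball (0 : EuclideanSpace ℝ (Fin (d + 1))) (4 * R) ∩ Ω with hU
  have hUΩ : U ⊆ Ω := inter_subset_right
  have hUc : closure U ⊆ closure Ω := closure_mono hUΩ
  have hmain := le_of_ellipticOp_nonneg (f := fun x => f x + c * g x) (Nat.succ_pos d)
    (isOpen_ball.inter hΩ) (isBounded_ball.subset inter_subset_left) hδ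
    (fun x hx => ha x (hUΩ hx)) ((hfc.mono hUc).add (hgs.continuous.continuousOn.const_mul c))
    ((hf.mono hUΩ).add (contDiffOn_const.mul hgs.contDiffOn)) (K := M / β)
    (fun x hx => by
      have hx : x ∈ Ω := hUΩ hx
      rw [ellipticOp_add_const_mul c (hf.contDiffAt (hΩ.mem_nhds hx)) hgs.contDiffAt]
      refine add_nonneg (hL x hx) (mul_nonneg hc0 ((ha x hx).ellipticOp_exp_nonneg hγ0.le _ ?_))
      refine (hT x hx).trans (hgT.trans ?_)
      have := pow_le_pow_left₀ (by positivity) (hfar x (subset_closure hx)) 2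
      calc 2 * g₀ * (δ * ρ ^ 2) = 2 * γ * (δ * (ρ * R) ^ 2) := by rw [← hγR]; ring
        _ ≤ _ := by gcongr)
    (fun x hx => by
      have hxΩ : x ∈ closure Ω := hUc hx.1
      rcases frontier_inter_subset _ _ hx with hx | hx
      · have hnx : ‖x‖ = 4 * R := by simpa using frontier_ball_subset_sphere hx.1
        have h3 : 3 * R ≤ ‖x - y₀‖ := by
          have := norm_sub_norm_le x y₀
          linarith
        calc f x + c * g x ≤ M + c * Real.exp (-((3 : ℝ) ^ 2 * g₀)) := by
              gcongr
              · exact hfM x hxΩ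
              · exact hexp_le x 3 (by norm_num) h3
          _ = M / β * (β + Real.exp (g₀ * ρ ^ 2 - 9 * g₀)) := by
              rw [hc, mul_assoc, ← Real.exp_add, mul_add, div_mul_cancel₀ _ hβ0.ne']
              ring_nf
          _ = M / β := by rw [hβ]; ring
      · calc f x + c * g x ≤ 0 + c * Real.exp (-(ρ ^ 2 * g₀)) := by
              gcongr
              · exact hbd x hx.2
              · exact hexp_le x ρ hρ0.le (hfar x hxΩ)
          _ = M / β := by
              rw [hc, mul_assoc, ← Real.exp_add, show g₀ * ρ ^ 2 + -(ρ ^ 2 * g₀) = 0 by ring]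
              simp)
    x₀ (isOpen_ball.inter_closure ⟨by rw [mem_ball_zero_iff]; linarith, hx₀⟩)
  have hge : Real.exp (-(4 * g₀)) ≤ g x₀ := by
    apply Real.exp_le_exp.2
    have h1 : ‖x₀ - y₀‖ ≤ 2 * R := by
      have := norm_sub_le x₀ y₀
      linarith
    have h2 := mul_le_mul_of_nonneg_left (pow_le_pow_left₀ (norm_nonneg _) h1 2) hγ0.le
    have e : 4 * g₀ = γ * (2 * R) ^ 2 := by rw [← hγR]; ring
    rw [e]; linarith
  have h1 := mul_le_mul_of_nonneg_left hge hc0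
  have e : c * Real.exp (-(4 * g₀)) = M / β * Real.exp (g₀ * ρ ^ 2 - 4 * g₀) := by
    rw [hc, mul_assoc, ← Real.exp_add]; ring_nf
  have e2 : β' / β * M = M / β - M / β * Real.exp (g₀ * ρ ^ 2 - 4 * g₀) := by rw [hβ']; ring
  linarith

/-- A Phragmén–Lindelöf principle for domains omitting a cone. -/
lemma nonpos_of_coneK_subset_compl (hΩ : IsOpen Ω) (hh : 0 < h) (hK : coneK h ⊆ Ωᶜ)
    (hδ : 0 < δ) (ha : ∀ x ∈ Ω, IsEllipticArray δ (a x)) (hT : ∀ x ∈ Ω, ∑ j, a x j j ≤ T)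
    {f : EuclideanSpace ℝ (Fin (d + 1)) → ℝ} (hfc : ContinuousOn f (closure Ω))
    (hf : ContDiffOn ℝ 2 f Ω) (hL : ∀ x ∈ Ω, 0 ≤ ellipticOp (a x) f x)
    (hbd : ∀ x ∈ frontier Ω, f x ≤ 0) {M : ℝ} (hM : 0 ≤ M) (hfM : ∀ x ∈ closure Ω, f x ≤ M) :
    ∀ x ∈ closure Ω, f x ≤ 0 := by
  obtain ⟨θ, hθ0, hθ1, hθ⟩ := exists_factor_of_coneK_subset_compl hΩ hh hK hδ ha hT
  -- The factor `θ` depends on neither `f` nor `M`, so each improved bound can be fed back in.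
  have hpow : ∀ k : ℕ, ∀ x ∈ closure Ω, f x ≤ θ ^ k * M := by
    intro k
    induction k with
    | zero => simpa using hfM
    | succ k ih =>
      intro x hx
      have := hθ f hfc hf hL hbd _ (by positivity) ih x hx
      rwa [pow_succ', mul_assoc]
  intro x hx
  have hlim : Tendsto (fun k : ℕ => θ ^ k * M) atTop (𝓝 0) := by
    simpa using (tendsto_pow_atTop_nhds_zero_of_lt_one hθ0 hθ1).mul_const M
  exact ge_of_tendsto' hlim fun k => hpow k x hx

end PhragmenLindelof

/-! ### Convex bodies and boundary points with a unique normal. -/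

/-- A unit vector that is an outward normal at a point of a sphere touching `S` from inside
is the radial direction. -/
lemma IsUnitOutwardNormal.eq_of_closedBall_subset {m : ℕ} {S : Set (EuclideanSpace ℝ (Fin m))}
    {a q ν : EuclideanSpace ℝ (Fin m)} {ρ : ℝ} (hν : IsUnitOutwardNormal S a ν) (hρ : 0 < ρ)
    (hball : closedBall q ρ ⊆ S) (ha : ‖a - q‖ = ρ) : a - q = ρ • ν := by
  -- Testing the normal on `q + ρ ν ∈ S` gives `(a - q, ν) ≥ ρ = ‖a - q‖`, the equality case of
  -- Cauchy–Schwarz.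
  have h1 := hν.2 (q + ρ • ν) (hball (by simp [norm_smul, hν.1, abs_of_pos hρ]))
  have h2 : inner ℝ (q + ρ • ν - a) ν = ρ - inner ℝ (a - q) ν := by
    rw [show q + ρ • ν - a = ρ • ν - (a - q) by abel, inner_sub_left, real_inner_smul_left,
      real_inner_self_eq_norm_sq, hν.1]
    ring
  have h3 := real_inner_le_norm (a - q) ν
  rw [ha, hν.1, mul_one] at h3
  rw [← sub_eq_zero, ← norm_eq_zero, ← sq_eq_zero_iff, norm_sub_sq_real, ha, norm_smul,
    real_inner_smul_right, hν.1, Real.norm_eq_abs, abs_of_pos hρ]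
  nlinarith

/-- A boundary point lies outside the open set `D`, so Hahn–Banach separates it from `D`; the
inequality passes to the closure. -/
lemma IsConvexBody.exists_isUnitOutwardNormal {m : ℕ} {S : Set (EuclideanSpace ℝ (Fin m))}
    (hS : IsConvexBody S) {a : EuclideanSpace ℝ (Fin m)} (ha : a ∈ frontier S) :
    ∃ ν, IsUnitOutwardNormal S a ν := by
  obtain ⟨D, hDo, hDc, hDne, -, rfl⟩ := hS
  have haD : a ∉ D := fun h => ha.2 (interior_maximal subset_closure hDo h)
  obtain ⟨f, hf⟩ := geometric_hahn_banach_open_point hDc hDo haD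
  set w := (InnerProductSpace.toDual ℝ _).symm f with hw
  have hfw : ∀ y, f y = inner ℝ y w := fun y => by
    rw [real_inner_comm, hw, InnerProductSpace.toDual_symm_apply]
  have hw0 : w ≠ 0 := by
    rintro h0
    obtain ⟨y, hy⟩ := hDne
    have := hf y hy
    simp [hfw, h0] at this
  have hwn : 0 < ‖w‖ := norm_pos_iff.2 hw0
  refine ⟨‖w‖⁻¹ • w, by simp [norm_smul, hwn.ne'], fun y hy => ?_⟩
  have hle : inner ℝ y w ≤ inner ℝ a w := by
    refine closure_minimal (t := {y | inner ℝ y w ≤ inner ℝ a w}) (fun y hy => ?_)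
      (isClosed_le (by fun_prop) continuous_const) hy
    have := hf y hy
    rw [hfw, hfw] at this
    exact this.le
  rw [real_inner_smul_right, inner_sub_left]
  exact mul_nonpos_of_nonneg_of_nonpos (by positivity) (by linarith)

/-- A point outside a convex body is separated from it by a supporting hyperplane at a point
with a unique normal. -/
lemma IsConvexBody.exists_mem_unitNormals_inner_pos {m : ℕ}
    {S : Set (EuclideanSpace ℝ (Fin m))} (hS : IsConvexBody S) {z : EuclideanSpace ℝ (Fin m)}
    (hz : z ∉ S) :
    ∃ a ν, ν ∈ unitNormals S ∧ IsUnitOutwardNormal S a ν ∧ 0 < inner ℝ (z - a) ν := by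
  obtain ⟨p, r, hr, hpr, hSc⟩ : ∃ p, ∃ r > 0, closedBall p r ⊆ S ∧ IsClosed S := by
    obtain ⟨D, hDo, -, ⟨p, hp⟩, -, rfl⟩ := hS
    obtain ⟨r, hr, h⟩ := nhds_basis_closedBall.mem_iff.1 (hDo.mem_nhds hp)
    exact ⟨p, r, hr, h.trans subset_closure, isClosed_closure⟩
  have hpS : p ∈ S := hpr (mem_closedBall_self hr.le)
  set e := infDist z S with he
  have he0 : 0 < e := (hSc.notMem_iff_infDist_pos ⟨p, hpS⟩).1 hz
  have heL : e ≤ ‖z - p‖ := by rw [← dist_eq_norm]; exact infDist_le_dist_of_mem hpS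
  set l := ‖z - p‖ with hl
  have hl0 : 0 < l := he0.trans_le heL
  -- The ball must be small enough that the normal at its contact point still separates `z`; any
  -- constant above 2 would serve in place of 4.
  set ρ := e * r / (4 * l) with hρ
  have hρ0 : 0 < ρ := by positivity
  have hρl : 4 * l * ρ = e * r := by rw [hρ]; field_simp
  have hρr : ρ < r := by nlinarith
  set q : ℝ → EuclideanSpace ℝ (Fin m) := fun t => p + t • (z - p) with hq
  have hzc : z ∈ Sᶜ := hz
  have hcont : Continuous fun t => infDist (q t) Sᶜ :=
    (continuous_infDist_pt _).comp (by fun_prop)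
  -- The centre slides from `p` towards `z` until its distance to the complement is exactly `ρ`. The
  -- ball then touches `∂S` from inside, which forces the normal at the contact point to be unique.
  obtain ⟨t, ⟨ht0, ht1⟩, ht⟩ : ρ ∈ (fun t => infDist (q t) Sᶜ) '' Icc 0 1 := by
    refine intermediate_value_Icc' zero_le_one hcont.continuousOn ⟨?_, ?_⟩
    · simp [hq, infDist_zero_of_mem hzc, hρ0.le]
    · refine (le_infDist ⟨z, hzc⟩).2 fun y hy => ?_
      by_contra! hlt
      refine hy (hpr ?_)
      simp only [hq, zero_smul, add_zero] at hlt
      rw [mem_closedBall, dist_comm]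
      linarith
  simp only at ht
  have hball : closedBall (q t) ρ ⊆ S := by
    rw [← closure_ball _ hρ0.ne', ← ht]
    exact closure_minimal ball_infDist_compl_subset hSc
  obtain ⟨a, haS, had⟩ := isClosed_closure.exists_infDist_eq_dist
    (closure_nonempty_iff.2 ⟨z, hzc⟩) (q t) (s := closure Sᶜ)
  rw [infDist_closure, ht, dist_comm, dist_eq_norm] at had
  have haS' : a ∈ S := hball (by rw [mem_closedBall, dist_eq_norm, ← had])
  have haf : a ∈ frontier S := by
    rw [frontier_eq_closure_inter_closure]
    exact ⟨subset_closure haS', haS⟩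
  obtain ⟨ν, hν⟩ := hS.exists_isUnitOutwardNormal haf
  have hνa := hν.eq_of_closedBall_subset hρ0 hball had.symm
  refine ⟨a, ν, ⟨a, haf, hν, fun ν₁ hν₁ => ?_⟩, hν, ?_⟩
  · have h := hν₁.eq_of_closedBall_subset hρ0 hball had.symm
    exact smul_right_injective _ hρ0.ne' (h.symm.trans hνa)
  set s := inner ℝ (z - p) ν with hs
  have hνν : inner ℝ ν ν = (1 : ℝ) := by rw [real_inner_self_eq_norm_sq, hν.1, one_pow]
  have haq : a = p + t • (z - p) + ρ • ν := by rw [← hνa]; simp [hq]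
  have h1 : r - ρ ≤ t * s := by
    have := hν.2 (p + r • ν) (hpr (by simp [norm_smul, hν.1, abs_of_pos hr]))
    rw [haq, show p + r • ν - (p + t • (z - p) + ρ • ν) = (r - ρ) • ν - t • (z - p) by module,
      inner_sub_left, real_inner_smul_left, real_inner_smul_left, hνν] at this
    linarith
  have h2 : e ≤ (1 - t) * l := by
    have h := infDist_le_dist_of_mem (x := z) (hball (mem_closedBall_self hρ0.le))
    rw [dist_eq_norm, show z - q t = (1 - t) • (z - p) by simp only [hq]; module, norm_smul,
      Real.norm_eq_abs, abs_of_nonneg (by linarith)] at h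
    exact h
  have h3 : inner ℝ (z - a) ν = (1 - t) * s - ρ := by
    rw [haq, show z - (p + t • (z - p) + ρ • ν) = (1 - t) • (z - p) - ρ • ν by module,
      inner_sub_left, real_inner_smul_left, real_inner_smul_left, hνν, mul_one]
  rw [h3]
  have hs0 : 0 < s := by
    by_contra! hs0
    nlinarith
  have hs1 : r - ρ ≤ s := by nlinarith
  -- Together these give `l (1 - t) s ≥ e (r - ρ) = 4lρ - eρ ≥ 3lρ > lρ`.
  have h4 : e * s ≤ l * ((1 - t) * s) := by nlinarith
  have h5 : e * (r - ρ) ≤ e * s := by gcongr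
  have h6 : e * ρ ≤ l * ρ := by gcongr
  have h7 : 0 < l * ((1 - t) * s - ρ) := by nlinarith [mul_pos hl0 hρ0]
  exact pos_of_mul_pos_right h7 hl0.le

/-! ### Reduction of the system to a scalar equation. -/

section Reduction

variable {n m : ℕ}

lemma ellipticOp_inner (a : Fin n → Fin n → ℝ)
    {u : EuclideanSpace ℝ (Fin n) → EuclideanSpace ℝ (Fin m)} {x : EuclideanSpace ℝ (Fin n)}
    (hu : ContDiffAt ℝ 2 u x) (c ν : EuclideanSpace ℝ (Fin m)) :
    ellipticOp a (fun y => inner ℝ (u y - c) ν) x =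
      ∑ j, ∑ k, a j k * inner ℝ (pderiv j (pderiv k u) x) ν := by
  have hdu : ∀ᶠ y in 𝓝 x, DifferentiableAt ℝ u y :=
    (hu.eventually (by simp)).mono fun _ hy => hy.differentiableAt (by norm_num)
  have hddu : DifferentiableAt ℝ (fderiv ℝ u) x :=
    (hu.fderiv_right (m := 1) (by norm_num)).differentiableAt (by norm_num)
  have h1 : fderiv ℝ (fun y => inner ℝ (u y - c) ν) =ᶠ[𝓝 x]
      fun y => (innerSL ℝ ν).comp (fderiv ℝ u y) := by
    filter_upwards [hdu] with y hy
    have h := (innerSL ℝ ν).hasFDerivAt.comp y (hy.hasFDerivAt.sub_const c)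
    have e : (fun y => inner ℝ (u y - c) ν) = innerSL ℝ ν ∘ fun y => u y - c := by
      funext y; exact real_inner_comm _ _
    rw [e, h.fderiv]
  have h2 : HasFDerivAt (fun y => (innerSL ℝ ν).comp (fderiv ℝ u y)) _ x :=
    (hasFDerivAt_const (innerSL ℝ ν) x).clm_comp hddu.hasFDerivAt
  refine Finset.sum_congr rfl fun j _ => Finset.sum_congr rfl fun k _ => ?_
  have h3 : pderiv j (pderiv k u) x =
      fderiv ℝ (fderiv ℝ u) x (EuclideanSpace.single j 1) (EuclideanSpace.single k 1) := by
    have : HasFDerivAt (pderiv k u) _ x :=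
      hddu.hasFDerivAt.clm_apply (hasFDerivAt_const (EuclideanSpace.single k (1 : ℝ)) x)
    rw [pderiv, this.fderiv]
    simp
  rw [h1.fderiv_eq, h2.fderiv, h3, real_inner_comm]
  simp

lemma dotProduct_ofLp_self {ν : EuclideanSpace ℝ (Fin m)} (hν : ‖ν‖ = 1) :
    WithLp.ofLp ν ⬝ᵥ WithLp.ofLp ν = 1 := by
  have := EuclideanSpace.real_norm_sq_eq ν
  rw [hν] at this
  simp only [dotProduct, ← pow_two]
  linarith

/-- A unit eigenvector of the transpose recovers its eigenvalue from the quadratic form. -/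
lemma mulVec_dotProduct_of_transpose_mulVec {A : Matrix (Fin m) (Fin m) ℝ}
    {ν : EuclideanSpace ℝ (Fin m)} {b : ℝ} (h : Aᵀ *ᵥ WithLp.ofLp ν = b • WithLp.ofLp ν)
    (w : Fin m → ℝ) : (A *ᵥ w) ⬝ᵥ WithLp.ofLp ν = b * (w ⬝ᵥ WithLp.ofLp ν) := by
  rw [dotProduct_comm, Matrix.dotProduct_mulVec, ← Matrix.mulVec_transpose, h, smul_dotProduct,
    dotProduct_comm, smul_eq_mul]

end Reduction

theorem theorem2 {d m : ℕ}
    (Ω : Set (EuclideanSpace ℝ (Fin (d + 1)))) (hΩ : IsDomainSet Ω)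
    (hΩ_type : Bornology.IsBounded Ω ∨
      (¬ Bornology.IsBounded Ω ∧ ∃ h : ℝ, 1 < h ∧ coneK h ⊆ Ωᶜ))
    (S : Set (EuclideanSpace ℝ (Fin m))) (hS : IsConvexBody S)
    (B : QuasilinearCoeffs (d + 1) m)
    (hB_bdd : BoundedCoeffs Ω B)
    (hB_ell : UniformlyStronglyElliptic Ω B)
    (hB_eig : ∃ b : Fin (d + 1) → Fin (d + 1) → EuclideanSpace ℝ (Fin (d + 1)) →
        Matrix (Fin m) (Fin (d + 1)) ℝ → EuclideanSpace ℝ (Fin m) → ℝ,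
      ∀ j k, ∀ x ∈ Ω, ∀ η : Matrix (Fin m) (Fin (d + 1)) ℝ, ∀ ν ∈ unitNormals S,
        (B j k x η)ᵀ *ᵥ WithLp.ofLp ν = b j k x η ν • WithLp.ofLp ν) :
    IsInvariantFor S Ω B := by
  obtain ⟨b, hb⟩ := hB_eig
  obtain ⟨δ, hδ, hell⟩ := hB_ell
  obtain ⟨C, hC⟩ := hB_bdd
  rintro u ⟨huc, ⟨M, hM⟩, hu, hsys⟩ hfr x₀ hx₀
  by_contra hz
  obtain ⟨c, ν, hνS, hν, hpos⟩ := hS.exists_mem_unitNormals_inner_pos hz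
  have hΩo := hΩ.1
  -- With `u` fixed, the eigenvalues along `D_x u` are the coefficients of a linear operator.
  set a : EuclideanSpace ℝ (Fin (d + 1)) → Fin (d + 1) → Fin (d + 1) → ℝ :=
    fun x j k => b j k x (gradient_array u x) ν with ha_def
  have hquad : ∀ x ∈ Ω, ∀ j k,
      (B j k x (gradient_array u x) *ᵥ WithLp.ofLp ν) ⬝ᵥ WithLp.ofLp ν = a x j k := by
    intro x hx j k
    rw [mulVec_dotProduct_of_transpose_mulVec (hb j k x hx _ ν hνS), dotProduct_ofLp_self hν.1,
      mul_one]
  have ha : ∀ x ∈ Ω, IsEllipticArray δ (a x) := by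
    intro x hx σ
    have h := hell x hx (gradient_array u x) σ ν
    rw [hν.1, one_pow, mul_one] at h
    refine h.trans_eq ?_
    simp only [Matrix.sum_mulVec, Matrix.smul_mulVec, sum_dotProduct, smul_dotProduct,
      hquad x hx, smul_eq_mul]
    exact Finset.sum_congr rfl fun j _ => Finset.sum_congr rfl fun k _ => mul_comm _ _
  have hνi : ∀ i, |ν i| ≤ 1 := fun i => by
    simpa [hν.1] using PiLp.norm_apply_le ν i
  -- The cone case needs this uniform trace bound to choose the barrier exponent.
  have hT : ∀ x ∈ Ω, ∑ j, a x j j ≤ ∑ _j : Fin (d + 1), ∑ _p : Fin m, ∑ _q : Fin m, C := by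
    intro x hx
    refine Finset.sum_le_sum fun j _ => ?_
    rw [← hquad x hx]
    simp only [dotProduct, Matrix.mulVec, Finset.sum_mul]
    refine Finset.sum_le_sum fun p _ => Finset.sum_le_sum fun q _ => ?_
    have h1 := hC j j x hx (gradient_array u x) p q
    refine (le_abs_self _).trans ?_
    rw [abs_mul, abs_mul]
    calc _ ≤ C * 1 * 1 := by
          have := (abs_nonneg _).trans h1
          gcongr
          · exact hνi q
          · exact hνi p
      _ = C := by ring
  set f : EuclideanSpace ℝ (Fin (d + 1)) → ℝ := fun x => inner ℝ (u x - c) ν with hf_def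
  have hfc : ContinuousOn f (closure Ω) := by fun_prop
  have hf : ContDiffOn ℝ 2 f Ω := (hu.sub contDiffOn_const).inner ℝ contDiffOn_const
  have hL : ∀ x ∈ Ω, 0 ≤ ellipticOp (a x) f x := by
    intro x hx
    rw [ellipticOp_inner (a x) (hu.contDiffAt (hΩo.mem_nhds hx)) c ν]
    have h := congrArg (· ⬝ᵥ WithLp.ofLp ν) (hsys x hx)
    simp only [sum_dotProduct, zero_dotProduct] at h
    refine (h.symm.trans ?_).le
    refine Finset.sum_congr rfl fun j _ => Finset.sum_congr rfl fun k _ => ?_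
    rw [mulVec_dotProduct_of_transpose_mulVec (hb j k x hx _ ν hνS), real_inner_comm,
      EuclideanSpace.inner_eq_star_dotProduct, star_trivial]
  have hbd : ∀ x ∈ frontier Ω, f x ≤ 0 := fun x hx => hν.2 _ (hfr x hx)
  refine hpos.not_ge (?_ : f x₀ ≤ 0)
  rcases hΩ_type with hbdd | ⟨-, h, hh, hK⟩
  · exact le_of_ellipticOp_nonneg (Nat.succ_pos d) hΩo hbdd hδ ha hfc hf hL hbd x₀ hx₀
  · have hfM : ∀ x ∈ closure Ω, f x ≤ M + ‖c‖ := fun x hx => by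
      have h1 := real_inner_le_norm (u x - c) ν
      rw [hν.1, mul_one] at h1
      linarith [norm_sub_le (u x) c, hM x hx]
    have hM0 : 0 ≤ M + ‖c‖ := add_nonneg ((norm_nonneg _).trans (hM x₀ hx₀)) (norm_nonneg _)
    exact nonpos_of_coneK_subset_compl hΩo (by linarith) hK hδ ha hT hfc hf hL hbd hM0 hfM x₀ hx₀
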